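/- For a compact Hausdorff topological group $G$ let $\mathrm{cp}(G)$ be the measure of the closed set $\{(x,y)\in G\times G : xy=yx\}$ with respect to the normalized Haar measure of the compact group $G\times G$; for a finite (discrete) group $H$ this is the proportion $|\{(x,y)\in H\times H: xy=yx\}|/|H|^2$. Let $FC(G)$ be the FC-center of $G$, i.e. the subgroup of all elements of $G$ whose conjugacy class is finite. For a group $T$ let $Z(T)$ be its center and $T'$ its derived subgroup. Two groups $H$ and $K$ are called isoclinic if there are isomorphisms $\alpha:H/Z(H)\to K/Z(K)$ and $\beta:H'\to K'$ such that $[x',y']=\beta([x,y])$ for all $x,y\in H$ and all $x'\in\alpha(xZ(H))$, $y'\in\alpha(yZ(H))$. Theorem. Let $G$ be a compact Hausdorff group. Then there is a finite group $H$ such that $$\mathrm{cp}(G)=\frac{\mathrm{cp}(H)}{|G:FC(G)|^2},$$ where $1/|G:FC(G)|$ is read as $0$ when the index is infinite. If moreover $\mathrm{cp}(G)>0$, then $FC(G)$ is compact in the subspace topology (so that $\mathrm{cp}(FC(G))$ is defined), and the finite group $H$ can be chosen so that, in addition, $H$ is isoclinic to $FC(G)$ and $\mathrm{cp}(FC(G))=\mathrm{cp}(H)$;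 in particular $$\mathrm{cp}(G)=\frac{\mathrm{cp}(FC(G))}{|G:FC(G)|^2},$$ and $\mathrm{cp}(G)$ is a rational number. -/

import Mathlib

open MeasureTheory TopologicalSpace
open scoped commutatorElement

/-- The commuting probability `cp(G)` of a compact group `G`: the measure of the (closed) set of
commuting pairs for the normalized Haar measure of the compact group `G × G`. The measure lives
on the Borel sigma-algebra of `G × G`, which may be larger than the product of two copies of the
Borel sigma-algebra of `G`. -/
noncomputable def cp (G : Type*) [Group G] [TopologicalSpace G] [IsTopologicalGroup G]
    [CompactSpace G] : ℝ :=
  letI : MeasurableSpace (G × G) := borel (G × G)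
  haveI : BorelSpace (G × G) := ⟨rfl⟩
  (Measure.haarMeasure (⊤ : PositiveCompacts (G × G))).real {p : G × G | p.1 * p.2 = p.2 * p.1}

/-- The FC-center of a group: the elements whose conjugacy class is finite. -/
def FC (G : Type*) [Group G] : Subgroup G where
  carrier := {x : G | (conjugatesOf x).Finite}
  one_mem' := by
    refine (Set.finite_singleton (1 : G)).subset ?_
    intro y hy
    simpa [conjugatesOf] using hy
  mul_mem' := by
    intro a b ha hb
    refine (Set.Finite.image2 (fun x y : G => x * y) ha hb).subset ?_
    intro y hy
    obtain ⟨g, rfl⟩ := isConj_iff.1 (show IsConj (a * b) y from hy)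
    exact ⟨g * a * g⁻¹, isConj_iff.2 ⟨g, rfl⟩, g * b * g⁻¹, isConj_iff.2 ⟨g, rfl⟩, by group⟩
  inv_mem' := by
    intro a ha
    refine (Set.Finite.image (fun x : G => x⁻¹) ha).subset ?_
    intro y hy
    obtain ⟨g, rfl⟩ := isConj_iff.1 (show IsConj a⁻¹ y from hy)
    exact ⟨g * a * g⁻¹, isConj_iff.2 ⟨g, rfl⟩, by group⟩

/-- Isoclinism of groups: isomorphisms `α : H / Z(H) → K / Z(K)` and `β : H' → K'` such that
`[x', y'] = β [x, y]` whenever `x'` and `y'` lie in the cosets `α (x Z(H))` and `α (y Z(H))`. -/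
def Isoclinic (H K : Type*) [Group H] [Group K] : Prop :=
  ∃ (α : H ⧸ Subgroup.center H ≃* K ⧸ Subgroup.center K) (β : commutator H ≃* commutator K),
    ∀ (x y : H) (x' y' : K),
      (x' : K ⧸ Subgroup.center K) = α (x : H ⧸ Subgroup.center H) →
      (y' : K ⧸ Subgroup.center K) = α (y : H ⧸ Subgroup.center H) →
        ⁅x', y'⁆ = (β ⟨⁅x, y⁆,
          Subgroup.commutator_mem_commutator (Subgroup.mem_top x) (Subgroup.mem_top y)⟩ : K)

/-!
Write `F` for the FC-center, `F_n` for the set of elements with at most `n` conjugates (a closed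
set, with `F = ⋃ n, F_n`) and `m` for the normalized Haar measure of `G × G`.

*Commuting pairs concentrate on `F × F`.* If `x` has more than `n` conjugates, then `n + 1`
translates of its centralizer are disjoint. Translating by `(1, t)` inside `G × G` and using
inner regularity, the commuting pairs with first entry outside `F_n` have measure at most
`1 / (n + 1)` (`measure_commutingPairs_compl_conjugatesLE_le`); hence those with an entry outside
`F` form a null set. If `F` has infinite index then `F × F` is itself null, and `cp G = 0`.

*Finite index makes `F` open with center of finite index.* By Baire, some `F_n` has interior. Take
`n` minimal. Near an interior point with exactly `n` conjugates, all conjugates of `y` are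
`t * y * t⁻¹` with `t` in a fixed finite set, and they stay distinct; so the relation
`g * y * g⁻¹ = t * y * t⁻¹` is open in `(y, g)`. This gives two open subgroups of `G` that centralize
each other (`exists_isOpen_le_centralizer`), from which `isOpen_FC` and `finiteIndex_center_FC`
follow. Comparing Haar measures on `F × F` and `G × G` gives `cp G = cp F / |G : F| ^ 2`.

*The finite group.* A group `F` whose center has finite index is isoclinic to a finitely generated
subgroup `T` containing representatives of the cosets of the center. The center of `T` is a finitely
generated abelian group of finite index; its subgroup of `k`-th powers is torsion-free for suitable
`k`, while its intersection with `T'` is torsion by the transfer. The quotient of `T` by these powers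
is thus finite and still isoclinic to `F` (`exists_finite_isoclinic`). Finally, the commuting
probability only depends on the isoclinism class, being the proportion of commuting pairs of cosets
of the center (`cp_eq_commProb_of_isoclinic`).
-/

/-! ### Isoclinism and finite quotients -/

theorem Isoclinic.symm {H K : Type*} [Group H] [Group K] (h : Isoclinic H K) :
    Isoclinic K H := by
  obtain ⟨α, β, hαβ⟩ := h
  refine ⟨α.symm, β.symm, fun x y x' y' hx hy => ?_⟩
  have h := hαβ x' y' x y (by rw [hx, α.apply_symm_apply]) (by rw [hy, α.apply_symm_apply])
  have h2 : (⟨⁅x, y⁆, Subgroup.commutator_mem_commutator (Subgroup.mem_top x)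
      (Subgroup.mem_top y)⟩ : commutator K) = β ⟨⁅x', y'⁆, Subgroup.commutator_mem_commutator
        (Subgroup.mem_top x') (Subgroup.mem_top y')⟩ := Subtype.ext h
  rw [h2, β.symm_apply_apply]

theorem Isoclinic.trans {H K L : Type*} [Group H] [Group K] [Group L] (h : Isoclinic H K)
    (h' : Isoclinic K L) : Isoclinic H L := by
  obtain ⟨α, β, hαβ⟩ := h
  obtain ⟨α', β', hαβ'⟩ := h'
  refine ⟨α.trans α', β.trans β', fun x y x'' y'' hx hy => ?_⟩
  obtain ⟨x', hx'⟩ := QuotientGroup.mk_surjective (α x)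
  obtain ⟨y', hy'⟩ := QuotientGroup.mk_surjective (α y)
  rw [hαβ' x' y' x'' y'' (by rw [hx, hx']; rfl) (by rw [hy, hy']; rfl)]
  have h2 : (⟨⁅x', y'⁆, Subgroup.commutator_mem_commutator (Subgroup.mem_top x')
      (Subgroup.mem_top y')⟩ : commutator K) = β ⟨⁅x, y⁆, Subgroup.commutator_mem_commutator
        (Subgroup.mem_top x) (Subgroup.mem_top y)⟩ := Subtype.ext (hαβ x y x' y' hx' hy')
  rw [h2]
  rfl

theorem commutatorElement_mul_center {K : Type*} [Group K] {a b z w : K}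
    (hz : z ∈ Subgroup.center K) (hw : w ∈ Subgroup.center K) : ⁅a * z, b * w⁆ = ⁅a, b⁆ := by
  have hz' := Subgroup.mem_center_iff.1 hz (b * w)
  have hw' := Subgroup.mem_center_iff.1 hw a⁻¹
  simp only [commutatorElement_def]
  calc a * z * (b * w) * (a * z)⁻¹ * (b * w)⁻¹
      = a * (z * (b * w)) * z⁻¹ * a⁻¹ * (b * w)⁻¹ := by group
    _ = a * b * (w * a⁻¹) * w⁻¹ * b⁻¹ := by rw [← hz']; group
    _ = a * b * a⁻¹ * b⁻¹ := by rw [← hw']; group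

/-- The two basic sources of isoclinism, combined: adjoining central factors to the range of a
homomorphism, and dividing by a normal subgroup that meets the derived subgroup trivially. -/
theorem Isoclinic.of_hom {T K : Type*} [Group T] [Group K] (f : T →* K)
    (hsurj : ∀ k : K, ∃ t, (f t)⁻¹ * k ∈ Subgroup.center K)
    (hker : ∀ t ∈ commutator T, f t = 1 → t = 1) : Isoclinic T K := by
  have hcomm : ∀ s t : T, ⁅s, t⁆ ∈ commutator T := fun s t =>
    Subgroup.commutator_mem_commutator (Subgroup.mem_top s) (Subgroup.mem_top t)
  have hcenter : Subgroup.center T = (Subgroup.center K).comap f := by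
    ext t
    rw [Subgroup.mem_comap]
    constructor
    · intro ht
      rw [Subgroup.mem_center_iff] at ht ⊢
      intro k
      obtain ⟨s, hs⟩ := hsurj k
      have h1 := Subgroup.mem_center_iff.1 hs (f t)
      have h2 : f s * f t = f t * f s := by rw [← map_mul, ht s, map_mul]
      calc k * f t = f s * ((f s)⁻¹ * k * f t) := by group
        _ = f t * k := by rw [← h1, ← mul_assoc, h2]; group
    · intro ht
      rw [Subgroup.mem_center_iff] at ht ⊢
      intro s
      rw [← commutatorElement_eq_one_iff_mul_comm]
      apply hker _ (hcomm s t)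
      rw [map_commutatorElement, commutatorElement_eq_one_iff_mul_comm]
      exact ht (f s)
  let α₀ : T ⧸ Subgroup.center T →* K ⧸ Subgroup.center K :=
    QuotientGroup.map _ _ f hcenter.le
  have hα : Function.Bijective α₀ := by
    constructor
    · rw [injective_iff_map_eq_one]
      intro a
      induction a using QuotientGroup.induction_on with
      | H t =>
        intro h
        rw [QuotientGroup.eq_one_iff, hcenter]
        exact (QuotientGroup.eq_one_iff (f t)).1 h
    · intro k
      induction k using QuotientGroup.induction_on with
      | H k =>
        obtain ⟨t, ht⟩ := hsurj k
        exact ⟨t, QuotientGroup.eq.2 ht⟩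
  have hmap : (commutator T).map f = commutator K := by
    apply le_antisymm
    · rw [commutator_def, Subgroup.map_commutator, commutator_def]
      exact Subgroup.commutator_mono le_top le_top
    · rw [commutator_def K, Subgroup.commutator_le]
      intro a _ b _
      obtain ⟨s, hs⟩ := hsurj a
      obtain ⟨t, ht⟩ := hsurj b
      refine ⟨⁅s, t⁆, hcomm s t, ?_⟩
      rw [map_commutatorElement, ← commutatorElement_mul_center hs ht, mul_inv_cancel_left,
        mul_inv_cancel_left]
  let β₀ : commutator T →* commutator K :=
    (f.comp (commutator T).subtype).codRestrict _ fun t => hmap ▸ ⟨t, t.2, rfl⟩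
  have hβ : Function.Bijective β₀ := by
    constructor
    · rw [injective_iff_map_eq_one]
      intro t ht
      exact Subtype.ext (hker t t.2 (congrArg Subtype.val ht))
    · rintro ⟨k, hk⟩
      obtain ⟨t, ht, rfl⟩ := hmap ▸ hk
      exact ⟨⟨t, ht⟩, rfl⟩
  refine ⟨MulEquiv.ofBijective α₀ hα, MulEquiv.ofBijective β₀ hβ, fun x y x' y' hx hy => ?_⟩
  have hx' : (f x)⁻¹ * x' ∈ Subgroup.center K := QuotientGroup.eq.1 hx.symm
  have hy' : (f y)⁻¹ * y' ∈ Subgroup.center K := QuotientGroup.eq.1 hy.symm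
  change ⁅x', y'⁆ = f ⁅x, y⁆
  rw [map_commutatorElement, ← commutatorElement_mul_center (a := f x) (b := f y) hx' hy',
    mul_inv_cancel_left, mul_inv_cancel_left]

/-- The transfer into the center, which is a power map, kills commutators. -/
theorem pow_index_center_eq_one {T : Type*} [Group T] [(Subgroup.center T).FiniteIndex] {t : T}
    (ht : t ∈ commutator T) : t ^ (Subgroup.center T).index = 1 := by
  have hle : commutator T ≤ (MonoidHom.transferCenterPow T).ker := by
    rw [commutator_def, Subgroup.commutator_le]
    intro a _ b _
    rw [MonoidHom.mem_ker, map_commutatorElement, commutatorElement_eq_one_iff_mul_comm]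
    exact Subtype.ext (Subgroup.mem_center_iff.1 (Subtype.prop _) _)
  have h := hle ht
  rw [MonoidHom.mem_ker] at h
  rw [← MonoidHom.transferCenterPow_apply, h]
  rfl

/-- The torsion of a finitely generated abelian group has finite exponent. -/
theorem exists_pow_eq_one_of_isOfFinOrder (A : Type*) [CommGroup A] [Group.FG A] :
    ∃ k : ℕ, k ≠ 0 ∧ ∀ a : A, IsOfFinOrder a → a ^ k = 1 := by
  have : Module.Finite ℤ (Additive A) :=
    Module.Finite.iff_addGroup_fg.2 (GroupFG.iff_add_fg.1 ‹_›)
  have : Finite (Submodule.torsion ℤ (Additive A)) :=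
    Module.finite_of_fg_torsion _ Submodule.torsion_isTorsion
  refine ⟨Nat.card (Submodule.torsion ℤ (Additive A)), Nat.card_pos.ne', fun a ha => ?_⟩
  obtain ⟨n, hn, han⟩ := isOfFinOrder_iff_pow_eq_one.1 ha
  have hmem : Additive.ofMul a ∈ Submodule.torsion ℤ (Additive A) := by
    rw [Submodule.mem_torsion_iff]
    refine ⟨⟨n, mem_nonZeroDivisors_of_ne_zero (by exact_mod_cast hn.ne')⟩, ?_⟩
    change ((n : ℤ) • Additive.ofMul a) = 0
    rw [natCast_zsmul, ← ofMul_pow, han, ofMul_one]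
  have h : Nat.card (Submodule.torsion ℤ (Additive A)) •
      (⟨Additive.ofMul a, hmem⟩ : Submodule.torsion ℤ (Additive A)) = 0 := card_nsmul_eq_zero'
  have h' := congrArg Subtype.val h
  rw [Submodule.coe_smul_of_tower] at h'
  exact Additive.ofMul.injective (h')

open scoped IsMulCommutative in
/-- A finitely generated group with center of finite index is isoclinic to a finite quotient: the
quotient by a torsion-free subgroup of finite index in the center. -/
theorem exists_finite_isoclinic_of_fg (T : Type*) [Group T] [Group.FG T]
    [(Subgroup.center T).FiniteIndex] :
    ∃ (H : Type) (_ : Group H) (_ : Finite H), Isoclinic H T := by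
  obtain ⟨k, hk, hpow⟩ := exists_pow_eq_one_of_isOfFinOrder (Subgroup.center T)
  let R : Subgroup (Subgroup.center T) := (powMonoidHom k).range
  have hR : R.FiniteIndex := Subgroup.finiteIndex_range_powMonoidHom_of_fg _ hk
  let N : Subgroup T := R.map (Subgroup.center T).subtype
  have hNc : N ≤ Subgroup.center T := Subgroup.map_subtype_le R
  have hNn : N.Normal := ⟨fun n hn g => by
    rw [Subgroup.mem_center_iff.1 (hNc hn) g, mul_inv_cancel_right]
    exact hn⟩
  have hNf : N.FiniteIndex := by
    rw [Subgroup.finiteIndex_iff, Subgroup.index_map_subtype]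
    exact mul_ne_zero hR.index_ne_zero Subgroup.FiniteIndex.index_ne_zero
  have hNd : ∀ t ∈ commutator T, t ∈ N → t = 1 := by
    rintro _ ht ⟨_, ⟨z, rfl⟩, rfl⟩
    have h1 : (z ^ k) ^ (Subgroup.center T).index = 1 :=
      Subtype.ext (pow_index_center_eq_one ht)
    rw [← pow_mul] at h1
    have h2 : z ^ k = 1 := hpow z (isOfFinOrder_iff_pow_eq_one.2
      ⟨_, Nat.pos_of_ne_zero (mul_ne_zero hk Subgroup.FiniteIndex.index_ne_zero), h1⟩)
    exact congrArg Subtype.val h2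
  obtain ⟨H, gH, fH, ⟨e⟩⟩ := Finite.exists_type_univ_nonempty_mulEquiv (T ⧸ N)
  refine ⟨H, gH, .of_fintype H, Isoclinic.symm <|
    Isoclinic.of_hom (e.toMonoidHom.comp (QuotientGroup.mk' N)) (fun h => ?_) fun t ht h1 => ?_⟩
  · obtain ⟨t, ht⟩ := QuotientGroup.mk'_surjective N (e.symm h)
    refine ⟨t, ?_⟩
    have : (e.toMonoidHom.comp (QuotientGroup.mk' N)) t = h := by
      change e (QuotientGroup.mk' N t) = h
      rw [ht, e.apply_symm_apply]
    rw [this, inv_mul_cancel]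
    exact one_mem _
  · exact hNd t ht ((QuotientGroup.eq_one_iff t).1 (e.map_eq_one_iff.1 h1))

/-- A group with center of finite index is isoclinic to a finite group: it is isoclinic to the
subgroup generated by representatives of the cosets of its center. -/
theorem exists_finite_isoclinic (F : Type*) [Group F] [(Subgroup.center F).FiniteIndex] :
    ∃ (H : Type) (_ : Group H) (_ : Finite H), Isoclinic H F := by
  let r : F ⧸ Subgroup.center F → F := Quotient.out
  let T : Subgroup F := Subgroup.closure (Set.range r)
  have hT : ∀ k : F, ∃ t : T, (T.subtype t)⁻¹ * k ∈ Subgroup.center F := fun k =>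
    ⟨⟨r k, Subgroup.subset_closure ⟨k, rfl⟩⟩, QuotientGroup.eq.1 (QuotientGroup.out_eq' _)⟩
  have : Group.FG T := Group.closure_finite_fg _
  have hle : (Subgroup.center F).subgroupOf T ≤ Subgroup.center T := by
    intro t ht
    rw [Subgroup.mem_center_iff]
    exact fun s => Subtype.ext (Subgroup.mem_center_iff.1 ht s)
  have : (Subgroup.center T).FiniteIndex := Subgroup.finiteIndex_of_le hle
  obtain ⟨H, gH, fH, h⟩ := exists_finite_isoclinic_of_fg T
  exact ⟨H, gH, fH, h.trans (Isoclinic.of_hom T.subtype hT fun t _ h1 => Subtype.ext h1)⟩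

/-! ### Commuting probability and finite quotients -/

/-- A homomorphism onto a finite group pushes an invariant probability measure forward to the uniform
one. -/
theorem measureReal_preimage_of_surjective {K Q : Type*} [Group K] [MeasurableSpace K]
    [MeasurableMul K] (m : Measure K) [m.IsMulLeftInvariant] [IsProbabilityMeasure m]
    [Group Q] [Finite Q] (q : K →* Q) (hq : Function.Surjective q)
    (hker : MeasurableSet (q.ker : Set K)) (S : Set Q) :
    m.real (q ⁻¹' S) = S.ncard / Nat.card Q := by
  have hfib : ∀ a : K, q ⁻¹' {q a} = (fun h => a⁻¹ * h) ⁻¹' (q.ker : Set K) := fun a => by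
    ext h
    change q h = q a ↔ q (a⁻¹ * h) = 1
    rw [map_mul, map_inv, inv_mul_eq_one, eq_comm]
  have hmeas : ∀ c : Q, MeasurableSet (q ⁻¹' {c}) := fun c => by
    obtain ⟨a, rfl⟩ := hq c
    rw [hfib]
    exact measurable_const_mul _ hker
  have hm : ∀ c : Q, m.real (q ⁻¹' {c}) = m.real (q.ker : Set K) := fun c => by
    obtain ⟨a, rfl⟩ := hq c
    rw [hfib, measureReal_def, measure_preimage_mul, measureReal_def]
  have hcount : ∀ S : Set Q, m.real (q ⁻¹' S) = S.ncard * m.real (q.ker : Set K) := fun S => by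
    have hS : q ⁻¹' S = ⋃ c ∈ S.toFinite.toFinset, q ⁻¹' {c} := by
      ext
      simp
    rw [hS, measureReal_biUnion_finset (fun c _ d _ hcd =>
      Disjoint.preimage q (Set.disjoint_singleton.2 hcd)) fun c _ => hmeas c,
      Finset.sum_congr rfl fun c _ => hm c, Finset.sum_const, nsmul_eq_mul,
      Set.ncard_eq_toFinset_card S]
  have h1 := hcount Set.univ
  rw [Set.preimage_univ, probReal_univ, Set.ncard_univ] at h1
  rw [hcount S, eq_div_iff (by exact_mod_cast Nat.card_pos.ne'), mul_assoc, mul_comm (m.real _),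
    ← h1, mul_one]

instance isProbabilityMeasure_haarMeasure_top {K : Type*} [Group K] [TopologicalSpace K]
    [IsTopologicalGroup K] [CompactSpace K] [MeasurableSpace K] [BorelSpace K] :
    IsProbabilityMeasure (Measure.haarMeasure (⊤ : PositiveCompacts K)) :=
  ⟨Measure.haarMeasure_self⟩

/-- If commutation of two elements is determined by their images in a finite quotient, then the
commuting probability is a proportion of pairs of elements of this quotient. -/
theorem cp_eq_of_finite_quotient {K Q : Type*} [Group K] [TopologicalSpace K]
    [IsTopologicalGroup K] [CompactSpace K] [Group Q] [Finite Q] (q : K →* Q)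
    (hq : Function.Surjective q) (hker : IsClosed (q.ker : Set K)) (S : Set (Q × Q))
    (hS : ∀ x y : K, x * y = y * x ↔ (q x, q y) ∈ S) :
    cp K = S.ncard / (Nat.card Q : ℝ) ^ 2 := by
  let _ : MeasurableSpace (K × K) := borel (K × K)
  have : BorelSpace (K × K) := ⟨rfl⟩
  have h := measureReal_preimage_of_surjective
    (Measure.haarMeasure (⊤ : PositiveCompacts (K × K))) (q.prodMap q)
    (hq.prodMap hq) ?_ S
  · rw [Nat.card_prod, Nat.cast_mul, ← sq] at h
    rw [← h]
    change Measure.real _ _ = _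
    congr 1
    ext p
    exact hS p.1 p.2
  · refine IsClosed.measurableSet ?_
    have : ((q.prodMap q).ker : Set (K × K)) = (q.ker : Set K) ×ˢ (q.ker : Set K) := by
      ext p
      simp [MonoidHom.mem_ker, Prod.ext_iff]
    rw [this]
    exact hker.prod hker

theorem cp_eq_commProb (H : Type*) [Group H] [Finite H] [TopologicalSpace H]
    [DiscreteTopology H] [IsTopologicalGroup H] [CompactSpace H] : cp H = (commProb H : ℝ) := by
  rw [cp_eq_of_finite_quotient (MonoidHom.id H) Function.surjective_id (isClosed_discrete _)
    {p | Commute p.1 p.2} fun x y => Iff.rfl, commProb_def]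
  push_cast
  rfl

/-- The commuting probability of a compact group whose center is closed of finite index agrees
with that of any isoclinic finite group: both are the proportion of commuting pairs of cosets of
the center. -/
theorem cp_eq_commProb_of_isoclinic {F H : Type*} [Group F] [TopologicalSpace F]
    [IsTopologicalGroup F] [CompactSpace F] [(Subgroup.center F).FiniteIndex]
    (hF : IsClosed (Subgroup.center F : Set F)) [Group H] [Finite H] (h : Isoclinic H F) :
    cp F = (commProb H : ℝ) := by
  obtain ⟨α, β, hαβ⟩ := h
  let _ : TopologicalSpace H := ⊥
  have : DiscreteTopology H := ⟨rfl⟩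
  let Q := F ⧸ Subgroup.center F
  let π : F →* Q := QuotientGroup.mk' _
  let S : Set (Q × Q) := {p | ∃ x y : F, x * y = y * x ∧ π x = p.1 ∧ π y = p.2}
  have hS : ∀ x y : F, x * y = y * x ↔ (π x, π y) ∈ S := by
    refine fun x y => ⟨fun hxy => ⟨x, y, hxy, rfl, rfl⟩, fun ⟨x', y', hxy, hx, hy⟩ => ?_⟩
    rw [← commutatorElement_eq_one_iff_mul_comm] at hxy ⊢
    rw [← commutatorElement_mul_center (QuotientGroup.eq.1 hx) (QuotientGroup.eq.1 hy)] at hxy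
    simpa only [mul_inv_cancel_left] using hxy
  rw [← cp_eq_commProb H, cp_eq_of_finite_quotient π (QuotientGroup.mk'_surjective _)
    (by rwa [QuotientGroup.ker_mk']) S hS,
    cp_eq_of_finite_quotient (α.toMonoidHom.comp (QuotientGroup.mk' (Subgroup.center H)))
      (α.surjective.comp (QuotientGroup.mk'_surjective _)) (isClosed_discrete _) S]
  intro x y
  obtain ⟨x', hx⟩ := QuotientGroup.mk_surjective (α x)
  obtain ⟨y', hy⟩ := QuotientGroup.mk_surjective (α y)
  have h1 := hαβ x y x' y' hx hy
  change _ ↔ (α x, α y) ∈ S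
  rw [← hx, ← hy]
  refine Iff.trans ?_ (hS x' y')
  rw [← commutatorElement_eq_one_iff_mul_comm, ← commutatorElement_eq_one_iff_mul_comm, h1,
    OneMemClass.coe_eq_one, EmbeddingLike.map_eq_one_iff, ← OneMemClass.coe_eq_one]

/-! ### Elements with boundedly many conjugates -/

/-- The set of commuting pairs of elements of a group. -/
def commutingPairs (G : Type*) [Group G] : Set (G × G) := {p | p.1 * p.2 = p.2 * p.1}

/-- The set of elements of a group with at most `n` conjugates. The cardinality is taken in
`ℕ∞`, so that infinite conjugacy classes are excluded. -/
def conjugatesLE (G : Type*) [Group G] (n : ℕ) : Set G := {x | (conjugatesOf x).encard ≤ n}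

section Conjugates

variable {G : Type*} [Group G]

theorem conjugatesOf_eq_range (x : G) : conjugatesOf x = Set.range fun t : G => t * x * t⁻¹ := by
  ext y
  exact isConj_iff

theorem mem_FC_iff_exists_conjugatesLE {x : G} : x ∈ FC G ↔ ∃ n, x ∈ conjugatesLE G n := by
  constructor
  · intro h
    have h' : (conjugatesOf x).Finite := h
    exact ⟨(conjugatesOf x).ncard, h'.cast_ncard_eq.ge⟩
  · rintro ⟨n, hn⟩
    exact Set.finite_of_encard_le_coe hn

/-- Membership fails exactly if some `n + 1` conjugators give distinct conjugates; for fixed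
conjugators this is an open condition. -/
theorem notMem_conjugatesLE_iff {n : ℕ} {x : G} :
    x ∉ conjugatesLE G n ↔
      ∃ s : Finset G, s.card = n + 1 ∧ Set.InjOn (fun t : G => t * x * t⁻¹) s := by
  constructor
  · intro h
    have h' : ((n + 1 : ℕ) : ℕ∞) ≤ (conjugatesOf x).encard := by
      push_cast
      exact Order.add_one_le_of_lt (not_le.1 h)
    obtain ⟨r, hr, hrc⟩ := Set.exists_subset_encard_eq h'
    rw [conjugatesOf_eq_range, ← Set.image_univ] at hr
    obtain ⟨s, -, hs⟩ := Set.SurjOn.exists_bijOn_subset hr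
    have hsc : s.encard = ((n + 1 : ℕ) : ℕ∞) := by rw [← hrc, ← hs.image_eq, hs.injOn.encard_image]
    lift s to Finset G using Set.finite_of_encard_eq_coe hsc
    rw [Set.encard_coe_eq_coe_finsetCard] at hsc
    exact ⟨s, by exact_mod_cast hsc, hs.injOn⟩
  · rintro ⟨s, hs, hinj⟩ hx
    have h : ((fun t : G => t * x * t⁻¹) '' s).encard ≤ (conjugatesOf x).encard :=
      Set.encard_le_encard (by rw [conjugatesOf_eq_range]; exact Set.image_subset_range _ _)
    rw [hinj.encard_image, Set.encard_coe_eq_coe_finsetCard, hs] at h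
    have := h.trans hx
    norm_cast at this
    omega

theorem index_centralizer_singleton (x : G) :
    (Subgroup.centralizer {x}).index = (conjugatesOf x).ncard := by
  have h : (Subgroup.centralizer {x}).index = (MulAction.stabilizer (ConjAct G) x).index := by
    rw [Subgroup.centralizer_eq_comap_stabilizer]
    exact Subgroup.index_comap_of_surjective _ ConjAct.toConjAct.surjective
  rw [h, MulAction.index_stabilizer, ConjAct.orbit_eq_carrier_conjClasses]
  rfl

theorem mem_FC_iff_finiteIndex_centralizer {x : G} :
    x ∈ FC G ↔ (Subgroup.centralizer {x}).FiniteIndex := by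
  rw [Subgroup.finiteIndex_iff, index_centralizer_singleton]
  constructor
  · intro h
    exact (Set.ncard_pos h).2 ⟨x, mem_conjugatesOf_self⟩ |>.ne'
  · exact Set.finite_of_ncard_ne_zero

variable [TopologicalSpace G] [IsTopologicalGroup G] [T2Space G]

theorem isOpen_setOf_injOn_conj (s : Finset G) :
    IsOpen {x : G | Set.InjOn (fun t : G => t * x * t⁻¹) s} := by
  have h : {x : G | Set.InjOn (fun t : G => t * x * t⁻¹) s} =
      ⋂ t ∈ s, ⋂ u ∈ s, ⋂ _ : t ≠ u, {x | t * x * t⁻¹ ≠ u * x * u⁻¹} := by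
    ext x
    simp only [Set.mem_iInter, Set.mem_ofPred_eq, Set.InjOn, SetLike.mem_coe]
    exact forall₄_congr fun t _ u _ => by rw [not_imp_not]
  rw [h]
  exact isOpen_biInter_finset fun t _ => isOpen_biInter_finset fun u _ =>
    isOpen_iInter_of_finite fun _ => isOpen_ne_fun (by fun_prop) (by fun_prop)

theorem isClosed_conjugatesLE (n : ℕ) : IsClosed (conjugatesLE G n) := by
  rw [← isOpen_compl_iff, isOpen_iff_mem_nhds]
  intro x hx
  obtain ⟨s, hs, hinj⟩ := notMem_conjugatesLE_iff.1 hx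
  exact Filter.mem_of_superset ((isOpen_setOf_injOn_conj s).mem_nhds hinj)
    fun y hy => notMem_conjugatesLE_iff.2 ⟨s, hs, hy⟩

theorem isClosed_commutingPairs : IsClosed (commutingPairs G) :=
  isClosed_eq (by fun_prop) (by fun_prop)

end Conjugates

/-! ### The measure of the commuting pairs outside the FC-center -/

section Measure

variable {G : Type*} [Group G] [TopologicalSpace G] [IsTopologicalGroup G] [T2Space G]
  [MeasurableSpace (G × G)] [BorelSpace (G × G)]

/-- If the conjugators in `s` are separated by their action on every element of `B`, then the
translates by `(1, t)`, `t ∈ s`, of the commuting pairs over `B` are disjoint. -/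
theorem card_mul_measure_commutingPairs_le (m : Measure (G × G)) [m.IsMulLeftInvariant]
    (s : Finset G) {B : Set G} (hB : MeasurableSet (Prod.fst ⁻¹' B : Set (G × G)))
    (h : ∀ x ∈ B, Set.InjOn (fun t : G => t * x * t⁻¹) s) :
    s.card * m (commutingPairs G ∩ Prod.fst ⁻¹' B) ≤ m (Prod.fst ⁻¹' B) := by
  let A : G → Set (G × G) := fun t =>
    (fun p => ((1, t⁻¹) : G × G) * p) ⁻¹' (commutingPairs G ∩ Prod.fst ⁻¹' B)
  have hA : ∀ t, ∀ p ∈ A t, p.1 ∈ B ∧ t * p.1 * t⁻¹ = p.2 * p.1 * p.2⁻¹ := by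
    rintro t ⟨x, y⟩ ⟨h1, h2⟩
    have h1' : 1 * x * (t⁻¹ * y) = t⁻¹ * y * (1 * x) := h1
    have h2' : 1 * x ∈ B := h2
    rw [one_mul] at h1' h2'
    refine ⟨h2', ?_⟩
    change t * x * t⁻¹ = y * x * y⁻¹
    calc t * x * t⁻¹ = t * (x * (t⁻¹ * y)) * y⁻¹ := by group
      _ = y * x * y⁻¹ := by rw [h1']; group
  have hmeas : MeasurableSet (commutingPairs G ∩ Prod.fst ⁻¹' B) :=
    isClosed_commutingPairs.measurableSet.inter hB
  calc s.card * m (commutingPairs G ∩ Prod.fst ⁻¹' B) = ∑ t ∈ s, m (A t) := by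
        simp only [A, measure_preimage_mul, Finset.sum_const, nsmul_eq_mul]
    _ = m (⋃ t ∈ s, A t) := by
        refine (measure_biUnion_finset ?_ fun t _ => measurable_const_mul _ hmeas).symm
        intro t ht u hu htu
        refine Set.disjoint_left.2 fun p hp hp' => htu ?_
        exact h p.1 (hA t p hp).1 ht hu ((hA t p hp).2.trans (hA u p hp').2.symm)
    _ ≤ m (Prod.fst ⁻¹' B) := measure_mono (Set.iUnion₂_subset fun t _ p hp => (hA t p hp).1)

/-- The Haar measure of the commuting pairs whose first entry has more than `n` conjugates. This
is a substitute for Fubini's theorem, which is not available for the Borel sigma-algebra of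
`G × G` when `G` is not second countable; inner regularity reduces it to finitely many open sets
on which `n + 1` distinct conjugates are produced by fixed conjugators. -/
theorem measure_commutingPairs_compl_conjugatesLE_le (m : Measure (G × G)) [m.IsMulLeftInvariant]
    [IsProbabilityMeasure m] [m.Regular] (n : ℕ) :
    m (commutingPairs G ∩ Prod.fst ⁻¹' (conjugatesLE G n)ᶜ) ≤ ((n + 1 : ℕ) : ENNReal)⁻¹ := by
  have hopen : ∀ {U : Set G}, IsOpen U → MeasurableSet (Prod.fst ⁻¹' U : Set (G × G)) :=
    fun hU => (hU.preimage continuous_fst).measurableSet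
  have hU := hopen (isClosed_conjugatesLE (G := G) n).isOpen_compl
  rw [(isClosed_commutingPairs.measurableSet.inter hU).measure_eq_iSup_isCompact_of_ne_top
    (measure_ne_top _ _)]
  refine iSup₂_le fun K hKs => iSup_le fun hK => ?_
  -- The property is stable under unions of open sets because it is required for all subsets `B`.
  let P : Set G → Prop := fun S => ∃ U, IsOpen U ∧ S ⊆ U ∧ ∀ B ⊆ U,
    MeasurableSet (Prod.fst ⁻¹' B : Set (G × G)) →
      ((n + 1 : ℕ) : ENNReal) * m (commutingPairs G ∩ Prod.fst ⁻¹' B) ≤ m (Prod.fst ⁻¹' B)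
  have hP : P (Prod.fst '' K) := by
    refine (hK.image continuous_fst).induction_on ?_ ?_ ?_ ?_
    · refine ⟨∅, isOpen_empty, subset_rfl, fun B hB _ => ?_⟩
      rw [Set.subset_empty_iff.1 hB]
      simp
    · rintro S T hST ⟨U, hU, hTU, h⟩
      exact ⟨U, hU, hST.trans hTU, h⟩
    · rintro S T ⟨U, hU, hSU, h⟩ ⟨V, hV, hTV, h'⟩
      refine ⟨U ∪ V, hU.union hV, Set.union_subset_union hSU hTV, fun B hB hBm => ?_⟩
      have e1 : (Prod.fst ⁻¹' (B ∩ U) : Set (G × G)) = Prod.fst ⁻¹' B ∩ Prod.fst ⁻¹' U := rfl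
      have e2 : (Prod.fst ⁻¹' (B \ U) : Set (G × G)) = Prod.fst ⁻¹' B \ Prod.fst ⁻¹' U := rfl
      have i1 := h (B ∩ U) Set.inter_subset_right (hBm.inter (hopen hU))
      have i2 := h' (B \ U) (fun x hx => (hB hx.1).resolve_left hx.2) (hBm.diff (hopen hU))
      rw [e1, ← Set.inter_assoc] at i1
      rw [e2, ← Set.inter_sdiff_assoc] at i2
      rw [← measure_inter_add_sdiff (commutingPairs G ∩ _) (hopen hU),
        ← measure_inter_add_sdiff (Prod.fst ⁻¹' B) (hopen hU), mul_add]
      exact add_le_add i1 i2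
    · rintro x ⟨p, hp, rfl⟩
      obtain ⟨s, hs, hinj⟩ := notMem_conjugatesLE_iff.1 (hKs hp).2
      refine ⟨_, mem_nhdsWithin_of_mem_nhds ((isOpen_setOf_injOn_conj s).mem_nhds hinj),
        _, isOpen_setOf_injOn_conj s, subset_rfl, fun B hB hBm => ?_⟩
      rw [← hs]
      exact card_mul_measure_commutingPairs_le m s hBm hB
  obtain ⟨U, hU, hKU, h⟩ := hP
  have h1 := (h U subset_rfl (hopen hU)).trans prob_le_one
  have h2 : m K ≤ m (commutingPairs G ∩ Prod.fst ⁻¹' U) :=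
    measure_mono fun p hp => ⟨(hKs hp).1, hKU ⟨p, hp, rfl⟩⟩
  refine h2.trans ?_
  rw [← one_div]
  refine (ENNReal.le_div_iff_mul_le (Or.inl (by simp)) (Or.inl (by simp))).2 ?_
  rwa [mul_comm]

theorem measure_commutingPairs_fst_notMem_FC (m : Measure (G × G)) [m.IsMulLeftInvariant]
    [IsProbabilityMeasure m] [m.Regular] :
    m (commutingPairs G ∩ Prod.fst ⁻¹' ((FC G : Set G)ᶜ)) = 0 := by
  refine le_antisymm ?_ zero_le
  refine ge_of_tendsto' ((Filter.tendsto_add_atTop_iff_nat 1).2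
    ENNReal.tendsto_inv_nat_nhds_zero) fun n => ?_
  refine (measure_mono ?_).trans (measure_commutingPairs_compl_conjugatesLE_le m n)
  exact fun p hp => ⟨hp.1, fun h => hp.2 (mem_FC_iff_exists_conjugatesLE.2 ⟨n, h⟩)⟩

theorem measurableSet_FC_prod_FC :
    MeasurableSet (((FC G).prod (FC G) : Subgroup (G × G)) : Set (G × G)) := by
  have h : (((FC G).prod (FC G) : Subgroup (G × G)) : Set (G × G)) =
      (⋃ n, Prod.fst ⁻¹' conjugatesLE G n) ∩ ⋃ n, Prod.snd ⁻¹' conjugatesLE G n := by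
    ext p
    simp only [Set.mem_inter_iff, Set.mem_iUnion, Set.mem_preimage,
      ← mem_FC_iff_exists_conjugatesLE]
    rfl
  rw [h]
  exact (MeasurableSet.iUnion fun n =>
      ((isClosed_conjugatesLE n).preimage continuous_fst).measurableSet).inter
    (MeasurableSet.iUnion fun n => ((isClosed_conjugatesLE n).preimage continuous_snd).measurableSet)

variable [CompactSpace G]

theorem measure_commutingPairs_snd_notMem_FC (m : Measure (G × G)) [m.IsHaarMeasure]
    [IsProbabilityMeasure m] :
    m (commutingPairs G ∩ Prod.snd ⁻¹' ((FC G : Set G)ᶜ)) = 0 := by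
  let e : G × G ≃* G × G := MulEquiv.prodComm
  have hc : Continuous e := continuous_swap
  have : (m.map e).IsHaarMeasure := e.isHaarMeasure_map m hc continuous_swap
  have : IsProbabilityMeasure (m.map e) := Measure.isProbabilityMeasure_map hc.aemeasurable
  rw [← measure_commutingPairs_fst_notMem_FC m,
    ← Measure.isHaarMeasure_eq_of_isProbabilityMeasure (m.map e) m]
  have h := (Homeomorph.prodComm G G).toMeasurableEquiv.map_apply (μ := m)
    (commutingPairs G ∩ Prod.snd ⁻¹' ((FC G : Set G)ᶜ))
  change (m.map e) _ = _ at h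
  rw [h, Measure.isHaarMeasure_eq_of_isProbabilityMeasure (m.map e) m]
  congr 1
  ext p
  exact and_congr_left fun _ => eq_comm

/-- Almost every commuting pair lies in the FC-center. -/
theorem measure_commutingPairs_inter_FC (m : Measure (G × G)) [m.IsHaarMeasure]
    [IsProbabilityMeasure m] :
    m (commutingPairs G) = m (commutingPairs G ∩ ((FC G).prod (FC G) : Subgroup (G × G))) := by
  refine le_antisymm ?_ (measure_mono Set.inter_subset_left)
  have hsub : commutingPairs G ⊆ (commutingPairs G ∩ ((FC G).prod (FC G) : Subgroup (G × G))) ∪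
      (commutingPairs G ∩ Prod.fst ⁻¹' ((FC G : Set G)ᶜ)) ∪
      (commutingPairs G ∩ Prod.snd ⁻¹' ((FC G : Set G)ᶜ)) := by
    intro p hp
    by_cases h1 : p.1 ∈ FC G
    · by_cases h2 : p.2 ∈ FC G
      · exact Or.inl (Or.inl ⟨hp, h1, h2⟩)
      · exact Or.inr ⟨hp, h2⟩
    · exact Or.inl (Or.inr ⟨hp, h1⟩)
  refine (measure_mono hsub).trans ((measure_union_le _ _).trans ?_)
  rw [measure_commutingPairs_snd_notMem_FC, add_zero]
  refine (measure_union_le _ _).trans ?_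
  rw [measure_commutingPairs_fst_notMem_FC, add_zero]

end Measure

theorem measure_subgroup_eq_zero_of_index_eq_zero {K : Type*} [Group K] [MeasurableSpace K]
    [MeasurableMul K] (m : Measure K) [m.IsMulLeftInvariant] [IsFiniteMeasure m] (N : Subgroup K)
    (hN : MeasurableSet (N : Set K)) (h : N.index = 0) : m N = 0 := by
  by_contra h0
  -- The cosets of `N` are infinitely many disjoint sets of equal measure.
  let A : K ⧸ N → Set K := fun c => (fun k => c.out⁻¹ * k) ⁻¹' (N : Set K)
  have hA : ∀ c, ∀ k ∈ A c, (k : K ⧸ N) = c := fun c k hk => by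
    rw [← QuotientGroup.out_eq' c]
    exact (QuotientGroup.eq.2 hk).symm
  have hfin := Measure.finite_const_le_meas_of_disjoint_iUnion m (pos_iff_ne_zero.2 h0)
    (As := A) (fun c => measurable_const_mul _ hN)
    (fun c d hcd => Set.disjoint_left.2 fun k hk hk' => hcd ((hA c k hk).symm.trans (hA d k hk')))
    (measure_ne_top _ _)
  have huniv : {c | m N ≤ m (A c)} = Set.univ :=
    Set.eq_univ_of_forall fun c => (measure_preimage_mul m _ _).ge
  rw [huniv, Set.finite_univ_iff] at hfin
  exact Subgroup.index_ne_zero_of_finite h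

section CompactGroup

variable (G : Type*) [Group G] [TopologicalSpace G] [IsTopologicalGroup G] [CompactSpace G]
  [T2Space G]

theorem cp_eq_zero_of_index_FC_eq_zero (h : (FC G).index = 0) : cp G = 0 := by
  let _ : MeasurableSpace (G × G) := borel (G × G)
  have : BorelSpace (G × G) := ⟨rfl⟩
  change (Measure.haarMeasure (⊤ : PositiveCompacts (G × G))).real (commutingPairs G) = 0
  rw [measureReal_def, measure_commutingPairs_inter_FC,
    measure_mono_null Set.inter_subset_right (measure_subgroup_eq_zero_of_index_eq_zero _ _
      measurableSet_FC_prod_FC (by rw [Subgroup.index_prod, h, zero_mul])), ENNReal.toReal_zero]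

/-- Haar measure of `G × G` restricts to a multiple of Haar measure on the open subgroup `F × F`, the
factor being the inverse of the index. -/
theorem cp_eq_cp_FC_div (hopen : IsOpen (FC G : Set G)) [(FC G).FiniteIndex]
    [CompactSpace (FC G)] : cp G = cp (FC G) / ((FC G).index : ℝ) ^ 2 := by
  let _ : MeasurableSpace (G × G) := borel (G × G)
  have : BorelSpace (G × G) := ⟨rfl⟩
  let _ : MeasurableSpace (FC G × FC G) := borel (FC G × FC G)
  have : BorelSpace (FC G × FC G) := ⟨rfl⟩
  let m := Measure.haarMeasure (⊤ : PositiveCompacts (G × G))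
  let m' := Measure.haarMeasure (⊤ : PositiveCompacts (FC G × FC G))
  let f : FC G × FC G →* G × G := (FC G).subtype.prodMap (FC G).subtype
  have hf : Topology.IsOpenEmbedding f :=
    hopen.isOpenEmbedding_subtypeVal.prodMap hopen.isOpenEmbedding_subtypeVal
  have hrange : Set.range f = ((FC G).prod (FC G) : Subgroup (G × G)) := by
    ext p
    exact ⟨by rintro ⟨⟨x, y⟩, rfl⟩; exact ⟨x.2, y.2⟩, fun h => ⟨(⟨p.1, h.1⟩, ⟨p.2, h.2⟩), rfl⟩⟩
  have hmul : MeasurableMul (G × G) := inferInstance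
  have : (m.comap f).IsHaarMeasure := Measure.IsHaarMeasure.comap (mH := hmul) m hf
  obtain ⟨c, hc⟩ : ∃ c : NNReal, m.comap f = c • m' :=
    ⟨_, Measure.isMulInvariant_eq_smul_of_compactSpace _ _⟩
  have happ : ∀ S, m (f '' S) = c * m' S := fun S => by
    rw [← hf.measurableEmbedding.comap_apply, hc]
    rfl
  have hc1 : ((FC G).index : ENNReal) ^ 2 * c = 1 := by
    have h1 := happ Set.univ
    rw [Set.image_univ, measure_univ, mul_one, hrange] at h1
    have h2 := ((FC G).prod (FC G)).index_mul_measure measurableSet_FC_prod_FC m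
    rw [measure_univ, h1, Subgroup.index_prod, Nat.cast_mul, ← sq] at h2
    exact h2
  have himg : commutingPairs G ∩ ((FC G).prod (FC G) : Subgroup (G × G)) =
      f '' commutingPairs (FC G) := by
    rw [← hrange, ← Set.image_preimage_eq_inter_range]
    congr 1
    ext p
    exact (Subtype.ext_iff (a1 := p.1 * p.2) (a2 := p.2 * p.1)).symm
  have hi : ((FC G).index : ℝ) ^ 2 ≠ 0 :=
    pow_ne_zero 2 (by exact_mod_cast Subgroup.FiniteIndex.index_ne_zero)
  change m.real (commutingPairs G) = m'.real (commutingPairs (FC G)) / _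
  rw [eq_div_iff hi, measureReal_def, measure_commutingPairs_inter_FC, himg, happ,
    ENNReal.toReal_mul, measureReal_def, mul_comm, ← mul_assoc]
  have := congrArg ENNReal.toReal hc1
  rw [ENNReal.toReal_mul, ENNReal.toReal_pow, ENNReal.toReal_natCast, ENNReal.toReal_one] at this
  rw [this, one_mul]

end CompactGroup

/-! ### FC-centers of finite index -/

section Interior

open scoped Pointwise

variable {G : Type*} [Group G] [TopologicalSpace G] [IsTopologicalGroup G] [CompactSpace G]
  [T2Space G]

/-- Finitely many translates of the closed sets `conjugatesLE G n`, `n : ℕ`, cover `G`, so that Baire's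
theorem applies. -/
theorem exists_nonempty_interior_conjugatesLE [(FC G).FiniteIndex] :
    ∃ n, (interior (conjugatesLE G n)).Nonempty := by
  let A : (G ⧸ FC G) × ℕ → Set G := fun i => i.1.out • conjugatesLE G i.2
  have hA : ⋃ i, A i = Set.univ := by
    refine Set.eq_univ_of_forall fun x => Set.mem_iUnion.2 ?_
    obtain ⟨n, hn⟩ := mem_FC_iff_exists_conjugatesLE.1
      (QuotientGroup.eq.1 (QuotientGroup.out_eq' (x : G ⧸ FC G)))
    exact ⟨(x, n), Set.mem_smul_set_iff_inv_smul_mem.2 hn⟩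
  obtain ⟨i, hi⟩ := nonempty_interior_of_iUnion_of_closed
    (fun i : (G ⧸ FC G) × ℕ => (isClosed_conjugatesLE i.2).smul i.1.out) hA
  rw [interior_smul, Set.smul_set_nonempty] at hi
  exact ⟨i.2, hi⟩

/-- Around a point with the generic number of conjugates, the conjugates of `y` are produced by
finitely many fixed conjugators and stay apart, so that which of them equals `g * y * g⁻¹` is
locally constant in `(y, g)`. -/
theorem exists_isOpen_conj_eq [(FC G).FiniteIndex] :
    ∃ W V : Set G, IsOpen W ∧ IsOpen V ∧ W.Nonempty ∧ ∃ t ∈ V, ∀ y ∈ W, ∀ g ∈ V,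
      g * y * g⁻¹ = t * y * t⁻¹ := by
  classical
  have hex := exists_nonempty_interior_conjugatesLE (G := G)
  obtain ⟨n, hn, hmin⟩ : ∃ n, (interior (conjugatesLE G n)).Nonempty ∧
      ∀ k < n, ¬ (interior (conjugatesLE G k)).Nonempty :=
    ⟨Nat.find hex, Nat.find_spec hex, fun k hk => Nat.find_min hex hk⟩
  obtain _ | k := n
  · obtain ⟨x, hx⟩ := hn
    have h0 : (conjugatesOf x).encard ≤ (0 : ℕ) :=
      show x ∈ conjugatesLE G 0 from interior_subset hx
    rw [Nat.cast_zero, nonpos_iff_eq_zero, Set.encard_eq_zero] at h0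
    exact absurd (h0 ▸ mem_conjugatesOf_self : x ∈ (∅ : Set G)) (Set.notMem_empty x)
  obtain ⟨x, hx, hxk⟩ : ∃ x ∈ interior (conjugatesLE G (k + 1)), x ∉ conjugatesLE G k := by
    by_contra! hsub
    exact hmin k (Nat.lt_succ_self k) (hn.mono (interior_maximal hsub isOpen_interior))
  obtain ⟨s, hs, hinj⟩ := notMem_conjugatesLE_iff.1 hxk
  -- On `U` the elements of `s` produce all the `k + 1` conjugates of `y`, without repetition.
  let U : Set G := interior (conjugatesLE G (k + 1)) ∩
    {y | Set.InjOn (fun t : G => t * y * t⁻¹) s}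
  have hU : IsOpen U := isOpen_interior.inter (isOpen_setOf_injOn_conj s)
  have hconj : ∀ y ∈ U, ∀ g : G, ∃ t ∈ s, t * y * t⁻¹ = g * y * g⁻¹ := by
    intro y hy g
    have hle : (conjugatesOf y).encard ≤ (k + 1 : ℕ) :=
      show y ∈ conjugatesLE G (k + 1) from interior_subset hy.1
    have hfin : ((fun t : G => t * y * t⁻¹) '' s).Finite := s.finite_toSet.image _
    have heq := hfin.eq_of_subset_of_encard_le (t := conjugatesOf y)
      (by rw [conjugatesOf_eq_range]; exact Set.image_subset_range _ _)
      (by rwa [hy.2.encard_image, Set.encard_coe_eq_coe_finsetCard, hs])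
    have hg : g * y * g⁻¹ ∈ (fun t : G => t * y * t⁻¹) '' s := by
      rw [heq, conjugatesOf_eq_range]
      exact ⟨g, rfl⟩
    exact hg
  obtain ⟨t, ht⟩ : s.Nonempty := Finset.card_pos.1 (by omega)
  let O : Set (G × G) := Prod.fst ⁻¹' U ∩
    ⋂ u ∈ s.erase t, {p | p.2 * p.1 * p.2⁻¹ ≠ u * p.1 * u⁻¹}
  have hO : IsOpen O := (hU.preimage continuous_fst).inter <|
    isOpen_biInter_finset fun u _ => isOpen_ne_fun (by fun_prop) (by fun_prop)
  have hxt : (x, t) ∈ O := by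
    refine ⟨⟨hx, hinj⟩, Set.mem_iInter₂.2 fun u hu h => ?_⟩
    exact Finset.ne_of_mem_erase hu (hinj ht (Finset.mem_of_mem_erase hu) h).symm
  obtain ⟨W, V, hW, hV, hxW, htV, hWV⟩ := isOpen_prod_iff.1 hO x t hxt
  refine ⟨W, V, hW, hV, ⟨x, hxW⟩, t, htV, fun y hy g hg => ?_⟩
  obtain ⟨hyU, hne⟩ := hWV (Set.mk_mem_prod hy hg)
  obtain ⟨u, hu, hug⟩ := hconj y hyU g
  by_cases hut : u = t
  · rw [← hug, hut]
  · exact absurd hug.symm (Set.mem_iInter₂.1 hne u (Finset.mem_erase.2 ⟨hut, hu⟩))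

/-- The subgroups are the centralizer of the set `W` of `exists_isOpen_conj_eq`, which contains a
translate of `V`, and the double centralizer, which contains `W`. -/
theorem exists_isOpen_le_centralizer [(FC G).FiniteIndex] :
    ∃ D E : Subgroup G, IsOpen (D : Set G) ∧ IsOpen (E : Set G) ∧
      E ≤ Subgroup.centralizer (D : Set G) := by
  obtain ⟨W, V, hW, hV, ⟨x, hx⟩, t, ht, h⟩ := exists_isOpen_conj_eq (G := G)
  refine ⟨Subgroup.centralizer W, Subgroup.centralizer (Subgroup.centralizer W : Set G), ?_, ?_,
    le_rfl⟩
  · refine Subgroup.isOpen_of_mem_nhds _ (g := 1) ?_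
    refine Filter.mem_of_superset ((hV.preimage (continuous_const_mul t)).mem_nhds
      (show t * 1 ∈ V by rwa [mul_one])) fun g hg => ?_
    refine Subgroup.mem_centralizer_iff.2 fun y hy => ?_
    have h1 := h y hy (t * g) hg
    calc y * g = t⁻¹ * (t * y * t⁻¹) * (t * g) := by group
      _ = g * y := by rw [← h1]; group
  · refine Subgroup.isOpen_of_mem_nhds _ (g := x) (Filter.mem_of_superset (hW.mem_nhds hx) ?_)
    exact fun y hy => Subgroup.mem_centralizer_iff.2 fun g hg =>
      (Subgroup.mem_centralizer_iff.1 hg y hy).symm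

theorem isOpen_FC [(FC G).FiniteIndex] : IsOpen (FC G : Set G) := by
  obtain ⟨D, E, hD, hE, hDE⟩ := exists_isOpen_le_centralizer (G := G)
  refine Subgroup.isOpen_mono (fun x hx => ?_) hE
  have : Finite (G ⧸ D) := D.quotient_finite_of_isOpen hD
  have : D.FiniteIndex := Subgroup.finiteIndex_of_finite_quotient
  refine mem_FC_iff_finiteIndex_centralizer.2 (Subgroup.finiteIndex_of_le (H := D) ?_)
  intro d hd
  rw [Subgroup.mem_centralizer_singleton_iff]
  exact Subgroup.mem_centralizer_iff.1 (hDE hx) d hd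

/-- The center of the FC-center contains the elements of the open subgroup `E` that centralize
representatives of the finitely many cosets of the open subgroup `D` centralized by `E`. -/
theorem finiteIndex_center_FC [(FC G).FiniteIndex] : (Subgroup.center (FC G)).FiniteIndex := by
  obtain ⟨D, E, hD, hE, hDE⟩ := exists_isOpen_le_centralizer (G := G)
  have : Finite (G ⧸ D) := D.quotient_finite_of_isOpen hD
  have : D.FiniteIndex := Subgroup.finiteIndex_of_finite_quotient
  have : Finite (G ⧸ E) := E.quotient_finite_of_isOpen hE
  have : E.FiniteIndex := Subgroup.finiteIndex_of_finite_quotient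
  let D' : Subgroup (FC G) := D.subgroupOf (FC G)
  let C : Subgroup G := ⨅ c : FC G ⧸ D', Subgroup.centralizer {(c.out : G)}
  have hC : C.FiniteIndex := Subgroup.finiteIndex_iInf fun c =>
    mem_FC_iff_finiteIndex_centralizer.1 c.out.2
  refine Subgroup.finiteIndex_of_le (H := (E ⊓ C).subgroupOf (FC G)) fun z hz => ?_
  obtain ⟨hzE, hzC⟩ := Subgroup.mem_inf.1 (Subgroup.mem_subgroupOf.1 hz)
  refine Subgroup.mem_center_iff.2 fun x => Subtype.ext ?_
  let c : FC G ⧸ D' := x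
  have h1 : c.out * (z : G) = z * c.out :=
    (Subgroup.mem_centralizer_singleton_iff.1 (Subgroup.mem_iInf.1 hzC c)).symm
  have hd : c.out⁻¹ * x ∈ D' := QuotientGroup.eq.1 (QuotientGroup.out_eq' c)
  have h2 : ((c.out : G)⁻¹ * x) * z = z * ((c.out : G)⁻¹ * x) :=
    Subgroup.mem_centralizer_iff.1 (hDE hzE) _ (Subgroup.mem_subgroupOf.1 hd)
  change (x : G) * z = z * x
  calc (x : G) * z = c.out * (((c.out : G)⁻¹ * x) * z) := by group
    _ = c.out * z * ((c.out : G)⁻¹ * x) := by rw [h2, mul_assoc]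
    _ = z * x := by rw [h1]; group

end Interior

/-! ### The commuting probability of a compact group -/

theorem theorem1 (G : Type*) [Group G] [TopologicalSpace G] [IsTopologicalGroup G]
    [CompactSpace G] [T2Space G] :
    -- `Subgroup.index` is `0` when infinite and `x / 0 = 0`, which is the convention `1 / ∞ = 0`
    (∃ (H : Type) (_ : Group H) (_ : Finite H),
      cp G = (commProb H : ℝ) / ((FC G).index : ℝ) ^ 2) ∧
    (0 < cp G →
      -- the FC-center is then a compact group, so that its commuting probability makes sense
      ∃ _ : CompactSpace (FC G),
        (∃ (H : Type) (_ : Group H) (_ : Finite H),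
          Isoclinic H (FC G) ∧
          cp (FC G) = (commProb H : ℝ) ∧
          cp G = (commProb H : ℝ) / ((FC G).index : ℝ) ^ 2) ∧
        cp G = cp (FC G) / ((FC G).index : ℝ) ^ 2 ∧
        ∃ q : ℚ, cp G = (q : ℝ)) := by
  by_cases hindex : (FC G).index = 0
  -- In infinite index both sides vanish, so that any finite group serves.
  · have h0 := cp_eq_zero_of_index_FC_eq_zero G hindex
    refine ⟨⟨Multiplicative (ZMod 1), inferInstance, inferInstance, ?_⟩,
      fun h => absurd h0 h.ne'⟩
    simp [h0, hindex]
  have : (FC G).FiniteIndex := ⟨hindex⟩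
  have hcompact : CompactSpace (FC G) :=
    isCompact_iff_compactSpace.1 ((FC G).isClosed_of_isOpen isOpen_FC).isCompact
  have := finiteIndex_center_FC (G := G)
  obtain ⟨H, gH, fH, hiso⟩ := exists_finite_isoclinic (FC G)
  have hF : cp (FC G) = (commProb H : ℝ) := by
    refine cp_eq_commProb_of_isoclinic ?_ hiso
    rw [← Subgroup.centralizer_univ]
    exact Set.isClosed_centralizer _
  have hG := cp_eq_cp_FC_div G isOpen_FC
  have hGH : cp G = (commProb H : ℝ) / ((FC G).index : ℝ) ^ 2 := by rw [hG, hF]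
  exact ⟨⟨H, gH, fH, hGH⟩, fun _ => ⟨hcompact, ⟨H, gH, fH, hiso, hF, hGH⟩, hG,
    commProb H / (FC G).index ^ 2, by rw [hGH]; push_cast; rfl⟩⟩
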